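/- For a prime $p$ and $s\in\mathbb Z_p$ let $\mathrm{Id}_s:\mathbb Z_p^2\to\{0,1\}$ be given by $\mathrm{Id}_s(h_0,h_1)=1$ if and only if $h_0+sh_1=0$ in $\mathbb Z_p$; it is the identity oracle of the quotient $G_{p,1}$ of $\mathbb Z_p^2$ by the line $\{h: h_0+sh_1=0\}$. Let $\mathrm{SECRET}(G_{p,1})$ be the problem of outputting $s$ (as a binary string of $M=\lceil\log_2 p\rceil$ bits), given oracle access to $\mathrm{Id}_s$ for an unknown $s\in\mathbb Z_p$. A $k$-query algorithm works on basis states $|x\rangle|a\rangle|z\rangle$ with $x\in\mathbb Z_p^2$, $a\in\{0,1\}$ and a finite work register $z$ of at least $M$ bits; on the initial state $|0\rangle|0\rangle|0\rangle$ it performs $U_0,O,U_1,O,\dots,O,U_k$, where $O|x\rangle|a\rangle|z\rangle=|x\rangle|a+\mathrm{Id}_s(x) \bmod 2\rangle|z\rangle$ and $U_0,\dots,U_k$ do not depend on $s$. The $U_i$ are unitary in the quantum model and stochastic (acting on probability vectors) in the randomized model. The algorithm solves the problem if for every $s\in\mathbb Z_p$, observing the last $M$ bits of the work register at the end yields $s$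 with probability at least $2/3$. The randomized (respectively quantum) query complexity is the smallest $k$ for which a $k$-query randomized (respectively quantum) algorithm solves the problem. Then the randomized query complexity of $\mathrm{SECRET}(G_{p,1})$ is $\Theta(p)$ and its quantum query complexity is $\Theta(\sqrt p)$: there are absolute constants $c,C>0$ such that for every prime $p$ the former lies between $cp$ and $Cp$ and the latter between $c\sqrt p$ and $C\sqrt p$. -/

import Mathlib

namespace QueryModel

/-- A functional oracle problem `A : S → {0,1}^M` with `S` a set of Boolean functions on the
finite set `X` of possible queries. -/
structure OracleProblem (X : Type) (M : ℕ) where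
  domain : Set (X → Bool)
  answer : domain → (Fin M → Bool)

/-- Labels of the basis states `|x⟩|a⟩|z⟩`: a query register, an answer bit, and a work register
`z` of `w + M` bits, split into its first `w` bits and its last `M` bits. -/
abbrev BasisState (X : Type) (w M : ℕ) : Type :=
  X × Bool × (Fin w → Bool) × (Fin M → Bool)

/-- `|x⟩|a⟩|z⟩ ↦ |x⟩|a + f(x) mod 2⟩|z⟩` on labels of basis states. -/
def queryMap {X : Type} {w M : ℕ} (f : X → Bool) (b : BasisState X w M) : BasisState X w M :=
  (b.1, xor b.2.1 (f b.1), b.2.2)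

/-- The query operation `O_f`: its column at the basis state `j` is the basis vector
of `queryMap f j`. -/
def queryOp (R : Type) [Semiring R] {X : Type} [DecidableEq X] {w M : ℕ} (f : X → Bool) :
    Matrix (BasisState X w M) (BasisState X w M) R :=
  Matrix.of fun i j => if i = queryMap f j then 1 else 0

/-- The initial state `|0⟩|0⟩|0⟩`. -/
def initialState (R : Type) [Semiring R] {X : Type} [DecidableEq X] [Zero X] {w M : ℕ} :
    BasisState X w M → R :=
  Pi.single (0, false, (fun _ => false), (fun _ => false)) 1

/-- The state after applying `U 0, O_f, U 1, O_f, …, O_f, U k` to the initial state. -/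
def finalState {R : Type} [Semiring R] {X : Type} [Fintype X] [DecidableEq X] [Zero X]
    {w M : ℕ} (f : X → Bool) :
    (k : ℕ) → (Fin (k + 1) → Matrix (BasisState X w M) (BasisState X w M) R) →
      BasisState X w M → R
  | 0, U => (U 0).mulVec (initialState R)
  | k + 1, U =>
      (U (Fin.last (k + 1))).mulVec
        ((queryOp R f).mulVec (finalState f k fun i => U i.castSucc))

variable {X : Type} [Fintype X] [DecidableEq X] [Zero X] {M : ℕ}

/-- There is a `k`-query randomized algorithm (with a finite work register) which, on every
oracle `f` of the domain, outputs `A(f)` with probability at least `2/3`. The operations are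
stochastic matrices acting on column vectors of probabilities. -/
def RandomizedSolvable (P : OracleProblem X M) (k : ℕ) : Prop :=
  ∃ (w : ℕ) (U : Fin (k + 1) → Matrix (BasisState X w M) (BasisState X w M) ℝ),
    (∀ i, U i ∈ Matrix.colStochastic ℝ (BasisState X w M)) ∧
    ∀ f : P.domain,
      2 / 3 ≤ ∑ x : X, ∑ a : Bool, ∑ z : Fin w → Bool,
        finalState f.1 k U (x, a, z, P.answer f)

/-- There is a `k`-query quantum algorithm (with a finite work register) which, on every
oracle `f` of the domain, outputs `A(f)` with probability at least `2/3` when the last `M` bits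
of the work register are observed. -/
def QuantumSolvable (P : OracleProblem X M) (k : ℕ) : Prop :=
  ∃ (w : ℕ) (U : Fin (k + 1) → Matrix (BasisState X w M) (BasisState X w M) ℂ),
    (∀ i, U i ∈ Matrix.unitaryGroup (BasisState X w M) ℂ) ∧
    ∀ f : P.domain,
      2 / 3 ≤ ∑ x : X, ∑ a : Bool, ∑ z : Fin w → Bool,
        ‖finalState f.1 k U (x, a, z, P.answer f)‖ ^ 2

/-- The randomized query complexity: the smallest `k` such that a `k`-query randomized
algorithm computes `A` on every input. (A positive value certifies that one exists.) -/
noncomputable def randomizedComplexity (P : OracleProblem X M) : ℕ :=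
  sInf {k | RandomizedSolvable P k}

/-- The quantum query complexity: the smallest `k` such that a `k`-query quantum
algorithm computes `A` on every input. (A positive value certifies that one exists.) -/
noncomputable def quantumComplexity (P : OracleProblem X M) : ℕ :=
  sInf {k | QuantumSolvable P k}

end QueryModel

namespace HiddenCyclicGroup

/-- The identity oracle `Id_n` on the ambient group `ℤ_p^{t+1}`: the characteristic function of
the hyperplane `{h | h · n = 0}`. -/
def idOracle {p t : ℕ} (n : Fin (t + 1) → ZMod p) (h : Fin (t + 1) → ZMod p) : Bool :=
  decide (h ⬝ᵥ n = 0)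

/-- The identity oracle `Id_s` of `G_{p,1}`, with normal vector `(1, s)`. -/
def secretOracle {p : ℕ} (s : ZMod p) : (Fin 2 → ZMod p) → Bool :=
  idOracle (t := 1) ![1, s]

/-- The number of bits used to write a residue modulo `p`. -/
def bitLength (p : ℕ) : ℕ := Nat.clog 2 p

/-- The binary encoding of a residue modulo `p`. -/
def encode {p : ℕ} (s : ZMod p) : Fin (bitLength p) → Bool :=
  fun i => s.val.testBit i

/-- `SECRET(G_{p,1})`: the oracle input is `Id_s` for some `s ∈ ℤ_p`, and the output is `s`. -/
noncomputable def secretProblem (p : ℕ) :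
    QueryModel.OracleProblem (Fin 2 → ZMod p) (bitLength p) where
  domain := Set.range secretOracle
  answer f := encode f.2.choose

theorem secretOracle_injective (p : ℕ) :
    Function.Injective (secretOracle : ZMod p → (Fin 2 → ZMod p) → Bool) := by
  intro s s' h
  have h1 := congrFun h ![s, -1]
  have h2 : s + -s' = 0 := by
    simpa [secretOracle, idOracle, dotProduct, Fin.sum_univ_two] using h1
  exact add_neg_eq_zero.mp h2

/-- The output of `SECRET(G_{p,1})` on the oracle `Id_s` is the secret `s`. -/
theorem secretProblem_answer (p : ℕ) (s : ZMod p) :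
    (secretProblem p).answer ⟨secretOracle s, s, rfl⟩ = encode s := by
  have h : ∃ y, secretOracle y = secretOracle s := ⟨s, rfl⟩
  exact congrArg encode (secretOracle_injective p h.choose_spec)

theorem encode_injective (p : ℕ) [NeZero p] :
    Function.Injective (encode : ZMod p → Fin (bitLength p) → Bool) := by
  intro s s' h
  apply ZMod.val_injective p
  have hp : p ≤ 2 ^ bitLength p := Nat.le_pow_clog (by norm_num) p
  apply Nat.eq_of_testBit_eq
  intro i
  by_cases hi : i < bitLength p
  · exact congrFun h ⟨i, hi⟩
  · have hpow : 2 ^ bitLength p ≤ 2 ^ i := Nat.pow_le_pow_right (by norm_num) (not_lt.mp hi)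
    rw [Nat.testBit_lt_two_pow ((ZMod.val_lt s).trans_le (hp.trans hpow)),
      Nat.testBit_lt_two_pow ((ZMod.val_lt s').trans_le (hp.trans hpow))]

end HiddenCyclicGroup

/-! Lower bounds: compare every `Id_s` with the oracle `g` that answers 1 only at the zero query.
All `Id_s` agree with `g` there, and the other points of the lines `h_0 + s h_1 = 0` are disjoint
for different `s`, so one query can be sensitive to many secrets only by dividing its mass among
them. The hybrid argument `norm_finalState_sub_le` makes this precise for all `ℓ^q` norms at once:
the family over `s` of deviations from the run on `g` has norm at most `2k`. A stochastic matrix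
contracts `ℓ^1` and a unitary one `ℓ^2`, so `q = 1` bounds the sum of the deviations by `2k` and `q
= 2` bounds the sum of their squares by `4k^2`. The run on `g` does not depend on `s`, so its
probabilities of the `p` distinct outputs sum to at most 1, while the actual success probabilities
sum to at least `2p/3`. Hence `k` is at least of order `p`, respectively `√p`.

Upper bounds: the query `(j, -1)` tests whether `j = s`. Trying every `j` takes `p` queries
(`finalState_searchOp`), and Grover search (`exists_grover_search`) takes `O(√p)`. -/

namespace QueryModel

open Matrix WithLp
open scoped ENNReal

/-! ### Mixed `ℓ^q` norms of families of vectors. -/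

section LpNorm

variable {q : ℝ≥0∞} [Fact (1 ≤ q)] {ι S 𝕜 : Type*} [Fintype ι] [Fintype S]

theorem toReal_exponent_pos (hq : q ≠ ⊤) : 0 < q.toReal :=
  ENNReal.toReal_pos (zero_lt_one.trans_le Fact.out).ne' hq

theorem norm_toLp_mono (hq : q ≠ ⊤) {E F : S → Type*} [∀ s, SeminormedAddCommGroup (E s)]
    [∀ s, SeminormedAddCommGroup (F s)] (v : ∀ s, E s) (u : ∀ s, F s)
    (h : ∀ s, ‖v s‖ ≤ ‖u s‖) : ‖toLp q v‖ ≤ ‖toLp q u‖ := by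
  have hq0 := toReal_exponent_pos hq
  rw [PiLp.norm_eq_sum hq0, PiLp.norm_eq_sum hq0]
  gcongr with s
  exact h s

theorem norm_toLp_comp_involutive (hq : q ≠ ⊤) {E : Type*} [SeminormedAddCommGroup E]
    {e : ι → ι} (he : Function.Involutive e) (v : ι → E) :
    ‖toLp q fun i => v (e i)‖ = ‖toLp q v‖ := by
  have hq0 := toReal_exponent_pos hq
  rw [PiLp.norm_eq_sum hq0, PiLp.norm_eq_sum hq0]
  congr 1
  exact Equiv.sum_comp he.toPerm fun i => ‖v i‖ ^ q.toReal

/-- Restrictions of a vector to disjoint sets have at most the norm of the vector. -/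
theorem norm_toLp_disjoint_restrict_le (hq : q ≠ ⊤) {E : Type*} [SeminormedAddCommGroup E]
    (D : S → ι → Prop) [∀ s i, Decidable (D s i)] (hD : ∀ s s' i, D s i → D s' i → s = s')
    (v : ι → E) :
    ‖toLp q fun s => toLp q fun i => if D s i then v i else 0‖ ≤ ‖toLp q v‖ := by
  have hq0 := toReal_exponent_pos hq
  have hn (s : S) : ‖toLp q fun i => if D s i then v i else 0‖ ^ q.toReal =
      ∑ i, if D s i then ‖v i‖ ^ q.toReal else 0 := by
    rw [PiLp.norm_eq_sum hq0, ← Real.rpow_mul (by positivity), one_div_mul_cancel hq0.ne',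
      Real.rpow_one]
    refine Finset.sum_congr rfl fun i _ => ?_
    by_cases h : D s i <;> simp [h, hq0.ne']
  rw [PiLp.norm_eq_sum hq0, PiLp.norm_eq_sum hq0]
  refine Real.rpow_le_rpow (by positivity) ?_ (by positivity)
  simp only [hn]
  rw [Finset.sum_comm]
  refine Finset.sum_le_sum fun i _ => ?_
  by_cases h : ∃ s, D s i
  · obtain ⟨s, hs⟩ := h
    rw [Finset.sum_eq_single s (fun s' _ hne => if_neg fun h' => hne (hD _ _ _ h' hs)) (by simp),
      if_pos hs]
  · simp only [not_exists] at h
    simp only [h, if_false, Finset.sum_const_zero]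
    positivity

end LpNorm

/-! ### The hybrid argument in `ℓ^q`. -/

section Hybrid

theorem queryMap_involutive {X : Type} {w M : ℕ} (f : X → Bool) :
    Function.Involutive (queryMap f : BasisState X w M → BasisState X w M) := by
  intro b
  simp [queryMap]

variable {𝕜 X : Type} [RCLike 𝕜] [Fintype X] [DecidableEq X] {w M : ℕ}

theorem queryOp_mulVec (R : Type) [Semiring R] (f : X → Bool) (v : BasisState X w M → R) :
    queryOp R f *ᵥ v = fun i => v (queryMap f i) := by
  funext i
  have h (j : BasisState X w M) : i = queryMap f j ↔ j = queryMap f i :=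
    ⟨fun h => h ▸ (queryMap_involutive f j).symm, fun h => h ▸ (queryMap_involutive f i).symm⟩
  simp [mulVec, dotProduct, queryOp, h]

variable {q : ℝ≥0∞} [Fact (1 ≤ q)]

theorem norm_queryOp_mulVec (hq : q ≠ ⊤) (f : X → Bool) (v : BasisState X w M → 𝕜) :
    ‖toLp q (queryOp 𝕜 f *ᵥ v)‖ = ‖toLp q v‖ := by
  rw [queryOp_mulVec, norm_toLp_comp_involutive hq (queryMap_involutive f)]

/-- Two query operations agree outside of the queries on which the oracles differ. -/
theorem queryOp_sub_mulVec (f g : X → Bool) (v : BasisState X w M → 𝕜) :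
    queryOp 𝕜 f *ᵥ v - queryOp 𝕜 g *ᵥ v =
      queryOp 𝕜 f *ᵥ (fun i => if f i.1 ≠ g i.1 then v i else 0) -
        queryOp 𝕜 g *ᵥ (fun i => if f i.1 ≠ g i.1 then v i else 0) := by
  funext i
  simp only [queryOp_mulVec, Pi.sub_apply]
  by_cases h : f i.1 = g i.1
  · simp [queryMap, h]
  · simp [queryMap, h]

variable [Zero X]

theorem norm_finalState_le (hq : q ≠ ⊤) (g : X → Bool) :
    ∀ (k : ℕ) (U : Fin (k + 1) → Matrix (BasisState X w M) (BasisState X w M) 𝕜),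
      (∀ i v, ‖toLp q (U i *ᵥ v)‖ ≤ ‖toLp q v‖) → ‖toLp q (finalState g k U)‖ ≤ 1
  | 0, U, hU => (hU 0 _).trans (by
      have := PiLp.norm_single q (fun _ : BasisState X w M => 𝕜)
        (0, false, (fun _ => false), (fun _ => false)) 1
      exact (this.trans norm_one).le)
  | k + 1, U, hU => (hU _ _).trans ((norm_queryOp_mulVec hq _ _).trans_le
      (norm_finalState_le hq g k (fun i => U i.castSucc) fun i => hU i.castSucc))

/-- The hybrid argument: if the oracles `f s` differ from `g` on disjoint sets of queries, then
`k` queries move the final states for `f s` away from that for `g` by at most `2 * k` in total. -/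
theorem norm_finalState_sub_le (hq : q ≠ ⊤) {S : Type*} [Fintype S] (f : S → X → Bool)
    (g : X → Bool) (hfg : ∀ s s' x, f s x ≠ g x → f s' x ≠ g x → s = s') :
    ∀ (k : ℕ) (U : Fin (k + 1) → Matrix (BasisState X w M) (BasisState X w M) 𝕜),
      (∀ i v, ‖toLp q (U i *ᵥ v)‖ ≤ ‖toLp q v‖) →
        ‖toLp q fun s => toLp q (finalState (f s) k U - finalState g k U)‖ ≤ 2 * k
  | 0, U, hU => by
      have : (fun s => toLp q (finalState (f s) 0 U - finalState g 0 U)) = 0 := by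
        funext s
        simp [finalState]
      rw [this]
      simp
  | k + 1, U, hU => by
      set U' : Fin (k + 1) → Matrix (BasisState X w M) (BasisState X w M) 𝕜 :=
        fun i => U i.castSucc
      set b := finalState g k U' with hb
      set r : S → BasisState X w M → 𝕜 := fun s i => if f s i.1 ≠ g i.1 then b i else 0
      have ih := norm_finalState_sub_le hq f g hfg k U' fun i => hU i.castSucc
      have hr : ‖toLp q fun s => toLp q (r s)‖ ≤ 1 :=
        (norm_toLp_disjoint_restrict_le hq (fun s (i : BasisState X w M) => f s i.1 ≠ g i.1)
          (fun s s' i => hfg s s' i.1) b).trans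
          (norm_finalState_le hq g k U' fun i => hU i.castSucc)
      -- One more query propagates the old deviation and adds the effect of the two oracles on the
      -- common state `b`. That effect only involves `r s`, the part of `b` on which they differ.
      -- The `r s` have disjoint supports, so their joint norm is at most 1, and the two new terms
      -- cost 2 per query.
      have hdec : (toLp q fun s => toLp q (finalState (f s) (k + 1) U - finalState g (k + 1) U)) =
          (toLp q fun s => toLp q (U (Fin.last (k + 1)) *ᵥ
            (queryOp 𝕜 (f s) *ᵥ (finalState (f s) k U' - b)))) +
          ((toLp q fun s => toLp q (U (Fin.last (k + 1)) *ᵥ (queryOp 𝕜 (f s) *ᵥ r s))) -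
          (toLp q fun s => toLp q (U (Fin.last (k + 1)) *ᵥ (queryOp 𝕜 g *ᵥ r s)))) := by
        rw [← toLp_sub, ← toLp_add]
        congr 1
        funext s
        simp only [Pi.add_apply, Pi.sub_apply]
        rw [← toLp_sub, ← toLp_add]
        congr 1
        rw [← mulVec_sub, ← queryOp_sub_mulVec, ← mulVec_add]
        simp only [finalState, mulVec_sub, mulVec_add]
        simp only [← hb, U']
        abel
      have h1 : ‖toLp q fun s => toLp q (U (Fin.last (k + 1)) *ᵥ
          (queryOp 𝕜 (f s) *ᵥ (finalState (f s) k U' - b)))‖ ≤ 2 * k :=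
        (norm_toLp_mono hq _ _ fun s => (hU _ _).trans (norm_queryOp_mulVec hq _ _).le).trans ih
      have h2 : ‖toLp q fun s => toLp q (U (Fin.last (k + 1)) *ᵥ (queryOp 𝕜 (f s) *ᵥ r s))‖ ≤ 1 :=
        (norm_toLp_mono hq _ _ fun s => (hU _ _).trans (norm_queryOp_mulVec hq _ _).le).trans hr
      have h3 : ‖toLp q fun s => toLp q (U (Fin.last (k + 1)) *ᵥ (queryOp 𝕜 g *ᵥ r s))‖ ≤ 1 :=
        (norm_toLp_mono hq _ _ fun s => (hU _ _).trans (norm_queryOp_mulVec hq _ _).le).trans hr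
      rw [hdec]
      refine (norm_add_le _ _).trans ?_
      have := norm_sub_le
        (toLp q fun s => toLp q (U (Fin.last (k + 1)) *ᵥ (queryOp 𝕜 (f s) *ᵥ r s)))
        (toLp q fun s => toLp q (U (Fin.last (k + 1)) *ᵥ (queryOp 𝕜 g *ᵥ r s)))
      push_cast
      linarith

end Hybrid

/-! ### Output probabilities and norm contraction. -/

section Measurement

variable {X : Type} [Fintype X] {w M : ℕ}

/-- Different outputs are disjoint events because `e` is injective. -/
theorem sum_output_le {S : Type*} [Fintype S] {e : S → Fin M → Bool}
    (he : Function.Injective e) (F : BasisState X w M → ℝ) (hF : ∀ b, 0 ≤ F b) :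
    ∑ s, ∑ x : X, ∑ a : Bool, ∑ z : Fin w → Bool, F (x, a, z, e s) ≤ ∑ b, F b := by
  simp only [Fintype.sum_prod_type]
  rw [Finset.sum_comm]
  refine Finset.sum_le_sum fun x _ => ?_
  rw [Finset.sum_comm]
  refine Finset.sum_le_sum fun a _ => ?_
  rw [Finset.sum_comm]
  refine Finset.sum_le_sum fun z _ => ?_
  classical
  rw [← Finset.sum_image (f := fun y => F (x, a, z, y)) (fun s _ s' _ h => he h)]
  exact Finset.sum_le_sum_of_subset_of_nonneg (Finset.subset_univ _) fun _ _ _ => hF _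

theorem output_le_sum (F : BasisState X w M → ℝ) (hF : ∀ b, 0 ≤ F b) (y : Fin M → Bool) :
    ∑ x : X, ∑ a : Bool, ∑ z : Fin w → Bool, F (x, a, z, y) ≤ ∑ b, F b := by
  simpa using sum_output_le (S := Unit) (e := fun _ => y) (fun _ _ _ => rfl) F hF

end Measurement

section Contraction

variable {ι : Type*} [Fintype ι] [DecidableEq ι]

theorem norm_mulVec_le_of_colStochastic {A : Matrix ι ι ℝ} (hA : A ∈ colStochastic ℝ ι)
    (v : ι → ℝ) : ‖toLp 1 (A *ᵥ v)‖ ≤ ‖toLp 1 v‖ := by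
  rw [PiLp.norm_eq_of_L1, PiLp.norm_eq_of_L1]
  calc ∑ i, ‖(A *ᵥ v) i‖ ≤ ∑ i, ∑ j, A i j * ‖v j‖ := by
        refine Finset.sum_le_sum fun i _ => (norm_sum_le _ _).trans_eq ?_
        refine Finset.sum_congr rfl fun j _ => ?_
        rw [norm_mul, Real.norm_of_nonneg (nonneg_of_mem_colStochastic hA)]
    _ = ∑ j, ‖v j‖ := by
        rw [Finset.sum_comm]
        refine Finset.sum_congr rfl fun j _ => ?_
        rw [← Finset.sum_mul, sum_col_of_mem_colStochastic hA, one_mul]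

theorem norm_mulVec_le_of_unitary {A : Matrix ι ι ℂ} (hA : A ∈ unitaryGroup ι ℂ)
    (v : ι → ℂ) : ‖toLp 2 (A *ᵥ v)‖ ≤ ‖toLp 2 v‖ := by
  have h : (A *ᵥ v) ⬝ᵥ star (A *ᵥ v) = v ⬝ᵥ star v := by
    rw [star_mulVec, dotProduct_comm, ← dotProduct_mulVec, mulVec_mulVec, ← star_eq_conjTranspose,
      mem_unitaryGroup_iff'.mp hA, one_mulVec, dotProduct_comm]
  have h' : (‖toLp 2 (A *ᵥ v)‖ : ℂ) ^ 2 = (‖toLp 2 v‖ : ℂ) ^ 2 := by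
    have e1 := EuclideanSpace.inner_toLp_toLp (𝕜 := ℂ) (A *ᵥ v) (A *ᵥ v)
    have e2 := EuclideanSpace.inner_toLp_toLp (𝕜 := ℂ) v v
    rw [inner_self_eq_norm_sq_to_K] at e1 e2
    exact e1.trans (h.trans e2.symm)
  have h2 : ‖toLp 2 (A *ᵥ v)‖ ^ 2 = ‖toLp 2 v‖ ^ 2 := by exact_mod_cast h'
  exact ((pow_left_inj₀ (norm_nonneg _) (norm_nonneg _) two_ne_zero).mp h2).le

end Contraction

end QueryModel

/-! ### The two lower bounds. -/

namespace HiddenCyclicGroup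

open QueryModel WithLp

/-- Away from the zero query, the oracles `Id_s` are supported on disjoint sets. -/
theorem secretOracle_disjoint (p : ℕ) [Fact p.Prime] (s s' : ZMod p) (x : Fin 2 → ZMod p)
    (h : secretOracle s x ≠ decide (x = 0)) (h' : secretOracle s' x ≠ decide (x = 0)) :
    s = s' := by
  have key (t : ZMod p) (ht : secretOracle t x ≠ decide (x = 0)) :
      x ≠ 0 ∧ x 0 + x 1 * t = 0 := by
    have : secretOracle t x = decide (x 0 + x 1 * t = 0) := by
      simp [secretOracle, idOracle, dotProduct, Fin.sum_univ_two]
    rw [this] at ht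
    by_cases hx : x = 0
    · subst hx; simp at ht
    · exact ⟨hx, by simpa [hx] using ht⟩
  obtain ⟨hx, h1⟩ := key s h
  obtain ⟨-, h2⟩ := key s' h'
  have hx1 : x 1 ≠ 0 := by
    intro h0
    refine hx (funext fun i => ?_)
    fin_cases i
    · simpa [h0] using h1
    · exact h0
  exact mul_left_cancel₀ hx1 (add_left_cancel (h1.trans h2.symm))

theorem randomized_lower_bound (p : ℕ) [Fact p.Prime] (k : ℕ)
    (h : RandomizedSolvable (secretProblem p) k) : (1 / 12 : ℝ) * p ≤ k := by
  obtain ⟨w, U, hU, hs⟩ := h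
  have hc (i) (v) := norm_mulVec_le_of_colStochastic (hU i) v
  set g : (Fin 2 → ZMod p) → Bool := fun x => decide (x = 0)
  have hd := norm_finalState_sub_le (q := 1) (by simp) (secretOracle (p := p)) g
    (secretOracle_disjoint p) k U hc
  have hn := norm_finalState_le (q := 1) (by simp) g k U hc
  rw [PiLp.norm_eq_of_L1] at hd hn
  set φ := finalState g k U
  have hsum : ∑ s : ZMod p, (2 / 3 : ℝ) ≤ ∑ s : ZMod p,
      (∑ x : Fin 2 → ZMod p, ∑ a : Bool, ∑ z : Fin w → Bool, ‖φ (x, a, z, encode s)‖ +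
        ‖toLp 1 (finalState (secretOracle s) k U - φ)‖) := by
    refine Finset.sum_le_sum fun s _ => ?_
    have h1 := hs ⟨secretOracle s, s, rfl⟩
    rw [secretProblem_answer] at h1
    have h2 := output_le_sum (fun b => ‖(finalState (secretOracle s) k U - φ) b‖)
      (fun _ => norm_nonneg _) (encode s)
    rw [PiLp.norm_eq_of_L1]
    refine h1.trans (le_trans ?_ (add_le_add_right h2 _))
    simp only [← Finset.sum_add_distrib]
    gcongr with x _ a _ z _
    have := norm_add_le (φ (x, a, z, encode s))
      ((finalState (secretOracle s) k U - φ) (x, a, z, encode s))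
    simp only [Pi.sub_apply, add_sub_cancel] at this ⊢
    exact (Real.le_norm_self _).trans this
  rw [Finset.sum_add_distrib] at hsum
  have h3 := sum_output_le (encode_injective p) (fun b => ‖φ b‖) fun _ => norm_nonneg _
  have hp : (2 : ℝ) ≤ p := by exact_mod_cast (Fact.out : p.Prime).two_le
  simp only [Finset.sum_const, Finset.card_univ, ZMod.card, nsmul_eq_mul] at hsum
  simp only at hd hn
  -- The inequalities combine to `2p/3 ≤ 1 + 2k`. Since `p ≥ 2`, the 1 is at most `p/2`, which
  -- leaves `p/6 ≤ 2k`.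
  linarith

theorem quantum_lower_bound (p : ℕ) [Fact p.Prime] (k : ℕ)
    (h : QuantumSolvable (secretProblem p) k) : (1 / 20 : ℝ) * Real.sqrt p ≤ k := by
  obtain ⟨w, U, hU, hs⟩ := h
  have hc (i) (v) := norm_mulVec_le_of_unitary (hU i) v
  set g : (Fin 2 → ZMod p) → Bool := fun x => decide (x = 0)
  have hd := norm_finalState_sub_le (q := 2) (by simp) (secretOracle (p := p)) g
    (secretOracle_disjoint p) k U hc
  have hn := norm_finalState_le (q := 2) (by simp) g k U hc
  replace hd := pow_le_pow_left₀ (norm_nonneg _) hd 2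
  replace hn := pow_le_pow_left₀ (norm_nonneg _) hn 2
  rw [PiLp.norm_sq_eq_of_L2] at hd hn
  set φ := finalState g k U
  -- The weights come from `(a + b)^2 ≤ (7/6) a^2 + 7 b^2`, whose defect is `(a - 6b)^2 / 6`. The
  -- weight of `a^2` must stay below `4/3` for the bound to be nontrivial at `p = 2`.
  have hsum : ∑ s : ZMod p, (2 / 3 : ℝ) ≤ ∑ s : ZMod p,
      (7 / 6 * (∑ x : Fin 2 → ZMod p, ∑ a : Bool, ∑ z : Fin w → Bool,
        ‖φ (x, a, z, encode s)‖ ^ 2) +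
        7 * ‖toLp 2 (finalState (secretOracle s) k U - φ)‖ ^ 2) := by
    refine Finset.sum_le_sum fun s _ => ?_
    have h1 := hs ⟨secretOracle s, s, rfl⟩
    rw [secretProblem_answer] at h1
    have h2 := output_le_sum (fun b => ‖(finalState (secretOracle s) k U - φ) b‖ ^ 2)
      (fun _ => by positivity) (encode s)
    rw [PiLp.norm_sq_eq_of_L2]
    refine h1.trans (le_trans ?_ (add_le_add_right
      (mul_le_mul_of_nonneg_left h2 (by norm_num : (0 : ℝ) ≤ 7)) _))
    simp only [Finset.mul_sum, ← Finset.sum_add_distrib]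
    gcongr with x _ a _ z _
    have := norm_add_le (φ (x, a, z, encode s))
      ((finalState (secretOracle s) k U - φ) (x, a, z, encode s))
    simp only [Pi.sub_apply, add_sub_cancel] at this ⊢
    refine (pow_le_pow_left₀ (norm_nonneg _) this 2).trans ?_
    nlinarith [sq_nonneg (‖φ (x, a, z, encode s)‖ -
      6 * ‖finalState (secretOracle s) k U (x, a, z, encode s) - φ (x, a, z, encode s)‖)]
  rw [Finset.sum_add_distrib, ← Finset.mul_sum, ← Finset.mul_sum] at hsum
  have h3 := sum_output_le (encode_injective p) (fun b => ‖φ b‖ ^ 2) fun _ => by positivity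
  have hp : (2 : ℝ) ≤ p := by exact_mod_cast (Fact.out : p.Prime).two_le
  simp only [Finset.sum_const, Finset.card_univ, ZMod.card, nsmul_eq_mul] at hsum
  simp only at hd hn
  -- From `2p/3 ≤ 7/6 + 28 k^2` and `7/6 ≤ 7p/12` one gets `p ≤ 336 k^2`.
  have hk : (p : ℝ) ≤ (20 * k) ^ 2 := by linarith
  have := Real.sqrt_le_sqrt hk
  rw [Real.sqrt_sq (by positivity)] at this
  linarith

end HiddenCyclicGroup

/-! ### Operations given by maps of basis states. -/

namespace QueryModel

open Matrix

section Deterministic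

variable {ι : Type*} [Fintype ι] [DecidableEq ι]

/-- The operation which maps the basis state `j` to the basis state `F j`. -/
def mapOp (R : Type*) [Semiring R] (F : ι → ι) : Matrix ι ι R :=
  Matrix.of fun i j => if i = F j then 1 else 0

theorem mapOp_mulVec_single (R : Type*) [Semiring R] (F : ι → ι) (j : ι) :
    mapOp R F *ᵥ Pi.single j 1 = Pi.single (F j) 1 := by
  funext i
  simp [mapOp, Pi.single_apply]

theorem mapOp_mem_colStochastic (F : ι → ι) : mapOp ℝ F ∈ colStochastic ℝ ι := by
  rw [mem_colStochastic_iff_sum]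
  refine ⟨fun i j => ?_, fun j => ?_⟩
  · simp only [mapOp, of_apply]
    positivity
  · simp [mapOp]

theorem mapOp_mulVec_of_involutive (R : Type*) [Semiring R] {F : ι → ι}
    (hF : Function.Involutive F) (v : ι → R) : mapOp R F *ᵥ v = fun i => v (F i) := by
  funext i
  have h (j : ι) : i = F j ↔ j = F i := ⟨fun h => h ▸ (hF j).symm, fun h => h ▸ (hF i).symm⟩
  simp [mulVec, dotProduct, mapOp, h]

theorem mapOp_mem_unitaryGroup {F : ι → ι} (hF : Function.Injective F) :
    mapOp ℂ F ∈ unitaryGroup ι ℂ := by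
  rw [mem_unitaryGroup_iff']
  ext i j
  simp [mapOp, mul_apply, star_apply, one_apply, hF.eq_iff, eq_comm]

end Deterministic

end QueryModel

/-! ### Randomized upper bound by exhaustive search. -/

namespace HiddenCyclicGroup

open QueryModel Matrix

theorem secretOracle_apply {p : ℕ} (s a b : ZMod p) :
    secretOracle s ![a, b] = decide (a + b * s = 0) := by
  simp [secretOracle, idOracle, dotProduct, Fin.sum_univ_two]

/-- One round of exhaustive search: record the candidate if it was confirmed by the last query,
and prepare the query for the next candidate. -/
def searchStep (p : ℕ) (b : BasisState (Fin 2 → ZMod p) 0 (bitLength p)) :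
    BasisState (Fin 2 → ZMod p) 0 (bitLength p) :=
  (![b.1 0 + 1, -1], false, b.2.2.1, if b.2.1 then encode (b.1 0) else b.2.2.2)

/-- The operations of exhaustive search over all secrets. -/
noncomputable def searchOp (p : ℕ) [NeZero p] (i : ℕ) :
    Matrix (BasisState (Fin 2 → ZMod p) 0 (bitLength p))
      (BasisState (Fin 2 → ZMod p) 0 (bitLength p)) ℝ :=
  mapOp ℝ (if i = 0 then fun b => (![0, -1], b.2) else searchStep p)

/-- After `k` queries the candidates `0, …, k - 1` have been tested and candidate `k` is loaded but
not yet asked, hence the strict inequality. Only `s` is ever confirmed, so a correct record is never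
spoiled. -/
theorem finalState_searchOp (p : ℕ) [NeZero p] (s : ZMod p) :
    ∀ k : ℕ, ∃ y : Fin (bitLength p) → Bool, (s.val < k → y = encode s) ∧
      finalState (secretOracle s) k (fun i : Fin (k + 1) => searchOp p i) =
        Pi.single (![(k : ZMod p), -1], false, (fun _ => false), y) 1
  | 0 => ⟨fun _ => false, by simp, by
      simp only [finalState, Fin.val_zero, searchOp, if_true, initialState, mapOp_mulVec_single,
        Nat.cast_zero]⟩
  | k + 1 => by
      obtain ⟨y, hy, hfin⟩ := finalState_searchOp p s k
      refine ⟨if (k : ZMod p) = s then encode s else y, fun hk => ?_, ?_⟩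
      · split_ifs with h
        · rfl
        · refine hy (lt_of_le_of_ne (Nat.lt_succ_iff.mp hk) fun h' => h ?_)
          rw [← h', ZMod.natCast_zmod_val]
      · have hq : queryOp ℝ (secretOracle s) = mapOp ℝ (queryMap (w := 0) (M := bitLength p)
          (secretOracle s)) := rfl
        simp only [finalState, Fin.val_castSucc]
        rw [hfin, hq, mapOp_mulVec_single, searchOp, Fin.val_last, if_neg (Nat.succ_ne_zero k),
          mapOp_mulVec_single]
        congr 1
        have h : (k : ZMod p) + -1 * s = 0 ↔ (k : ZMod p) = s := by
          rw [neg_one_mul, add_neg_eq_zero]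
        simp only [searchStep, queryMap, secretOracle_apply, h]
        by_cases hks : (k : ZMod p) = s <;> simp [hks]

theorem randomizedSolvable_secretProblem (p : ℕ) [NeZero p] :
    RandomizedSolvable (secretProblem p) p := by
  refine ⟨0, fun i => searchOp p i, fun i => mapOp_mem_colStochastic _, ?_⟩
  rintro ⟨_, s, rfl⟩
  rw [secretProblem_answer]
  obtain ⟨y, hy, hfin⟩ := finalState_searchOp p s p
  rw [hfin, hy (ZMod.val_lt s)]
  simp only [← Fintype.sum_prod_type']
  refine le_trans (by norm_num : (2 / 3 : ℝ) ≤ 1) ?_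
  refine le_trans ?_ (Finset.single_le_sum (fun _ _ => ?_)
    (Finset.mem_univ (![(p : ZMod p), -1], false, fun _ => false)))
  · simp
  · simp only [Pi.single_apply]
    positivity

end HiddenCyclicGroup

/-! ### Reflections and the Grover iteration. -/

namespace QueryModel

open Matrix

section Householder

variable {ι : Type*} [Fintype ι] [DecidableEq ι]

/-- The reflection in the hyperplane orthogonal to the unit vector `v`. -/
noncomputable def householder (v : ι → ℂ) : Matrix ι ι ℂ :=
  1 - (2 : ℂ) • vecMulVec v (star v)

theorem householder_mulVec (v u : ι → ℂ) :
    householder v *ᵥ u = u - (2 * (star v ⬝ᵥ u)) • v := by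
  rw [householder, sub_mulVec, one_mulVec, smul_mulVec, vecMulVec_mulVec, mul_smul]
  simp

theorem householder_mem_unitaryGroup {v : ι → ℂ} (hv : star v ⬝ᵥ v = 1) :
    householder v ∈ unitaryGroup ι ℂ := by
  have hstar : star (householder v) = householder v := by
    simp [householder, star_eq_conjTranspose, conjTranspose_vecMulVec]
  rw [mem_unitaryGroup_iff, hstar, ← mulVec_injective.eq_iff]
  funext u
  simp only [← mulVec_mulVec, householder_mulVec, dotProduct_sub, dotProduct_smul, hv,
    one_mulVec, smul_eq_mul]
  rw [sub_sub, ← add_smul]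
  ring_nf
  simp

theorem neg_mem_unitaryGroup {A : Matrix ι ι ℂ} (hA : A ∈ unitaryGroup ι ℂ) :
    -A ∈ unitaryGroup ι ℂ := by
  rw [mem_unitaryGroup_iff] at hA ⊢
  rw [star_neg, neg_mul_neg, hA]

end Householder

section Grover

variable {X : Type} [Fintype X] [DecidableEq X] {w M : ℕ}

/-- The label `|x⟩|a⟩|0⟩`. -/
def blankLabel (x : X) (a : Bool) : BasisState X w M :=
  (x, a, (fun _ => false), (fun _ => false))

/-- The state `|x⟩ (|0⟩ - |1⟩) / √2 |0⟩`. -/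
noncomputable def minusKet (x : X) : BasisState X w M → ℂ :=
  ((√2 : ℝ) : ℂ)⁻¹ • (Pi.single (blankLabel x false) 1 - Pi.single (blankLabel x true) 1)

theorem ofReal_sqrt_mul_self {a : ℝ} (ha : 0 ≤ a) : ((√a : ℝ) : ℂ) * (√a : ℝ) = a := by
  rw [← Complex.ofReal_mul, Real.mul_self_sqrt ha]

theorem inv_sqrt_two_mul_self : ((√2 : ℝ) : ℂ)⁻¹ * ((√2 : ℝ) : ℂ)⁻¹ = 1 / 2 := by
  rw [← mul_inv, ofReal_sqrt_mul_self (by norm_num)]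
  norm_num

theorem minusKet_dotProduct (x y : X) :
    star (minusKet x : BasisState X w M → ℂ) ⬝ᵥ minusKet y = if x = y then 1 else 0 := by
  have hs : star (minusKet x : BasisState X w M → ℂ) = minusKet x := by
    simp [minusKet, star_smul]
  rw [hs]
  simp only [minusKet, smul_dotProduct, dotProduct_smul, sub_dotProduct, dotProduct_sub,
    single_dotProduct, smul_eq_mul]
  by_cases hxy : x = y
  · subst hxy
    simp [blankLabel]
    linear_combination 2 * inv_sqrt_two_mul_self
  · simp [blankLabel, hxy]

/-- Phase kickback: flipping the answer bit exchanges the two terms of `|0⟩ - |1⟩`, so a positive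
answer becomes a sign. -/
theorem queryOp_mulVec_minusKet (f : X → Bool) (x : X) :
    queryOp ℂ f *ᵥ (minusKet x : BasisState X w M → ℂ) =
      (if f x then -1 else 1 : ℂ) • minusKet x := by
  have hq : queryOp ℂ f = mapOp ℂ (queryMap (w := w) (M := M) f) := rfl
  rw [hq, minusKet, mulVec_smul, mulVec_sub, mapOp_mulVec_single, mapOp_mulVec_single]
  cases h : f x
  · simp [queryMap, blankLabel, h]
  · simp [queryMap, blankLabel, h, ← smul_neg]

variable {τ : Type} [Fintype τ]

/-- The uniform superposition of the queries `t i`, with the answer register in the state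
`(|0⟩ - |1⟩) / √2`. -/
noncomputable def uniformKet (t : τ → X) : BasisState X w M → ℂ :=
  ((√(Fintype.card τ : ℝ) : ℝ) : ℂ)⁻¹ • ∑ i, minusKet (t i)

theorem star_uniformKet_dotProduct (t : τ → X) (u : BasisState X w M → ℂ) :
    star (uniformKet t : BasisState X w M → ℂ) ⬝ᵥ u =
      ((√(Fintype.card τ : ℝ) : ℝ) : ℂ)⁻¹ * ∑ i, star (minusKet (t i)) ⬝ᵥ u := by
  rw [uniformKet, star_smul, smul_dotProduct, star_sum, sum_dotProduct]
  simp

theorem uniformKet_dotProduct_minusKet {t : τ → X} (ht : Function.Injective t) (i : τ) :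
    star (uniformKet t : BasisState X w M → ℂ) ⬝ᵥ minusKet (t i) =
      ((√(Fintype.card τ : ℝ) : ℝ) : ℂ)⁻¹ := by
  classical
  simp [star_uniformKet_dotProduct, minusKet_dotProduct, ht.eq_iff]

theorem uniformKet_dotProduct_self [Nonempty τ] {t : τ → X} (ht : Function.Injective t) :
    star (uniformKet t : BasisState X w M → ℂ) ⬝ᵥ uniformKet t = 1 := by
  nth_rw 2 [uniformKet]
  rw [dotProduct_smul, dotProduct_sum]
  simp only [uniformKet_dotProduct_minusKet ht, Finset.sum_const, Finset.card_univ, nsmul_eq_mul,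
    smul_eq_mul]
  have h := ofReal_sqrt_mul_self (Nat.cast_nonneg (Fintype.card τ) : (0 : ℝ) ≤ _)
  have h0 : ((Fintype.card τ : ℝ) : ℂ) ≠ 0 := by simp
  rw [mul_left_comm, ← mul_inv, h]
  exact mul_inv_cancel₀ h0

variable [Zero X]

/-- The operations of Grover's algorithm: prepare the uniform superposition by a reflection, then
iterate the reflection about it. -/
noncomputable def groverOp (t : τ → X) (i : ℕ) :
    Matrix (BasisState X w M) (BasisState X w M) ℂ :=
  if i = 0 then householder (((√2 : ℝ) : ℂ)⁻¹ • (initialState ℂ - uniformKet t))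
  else -householder (uniformKet t)

/-- No candidate is the zero query, so the initial label is outside the support of `uniformKet t`.
Two orthogonal unit vectors differ by a vector of norm `√2`, and the reflection along it exchanges
them; this is the preparation step of `groverOp`. -/
theorem initialState_dotProduct_uniformKet {t : τ → X} (ht0 : ∀ i, t i ≠ 0) :
    star (initialState ℂ : BasisState X w M → ℂ) ⬝ᵥ uniformKet t = 0 ∧
      star (uniformKet t : BasisState X w M → ℂ) ⬝ᵥ initialState ℂ = 0 := by
  have h : (uniformKet t : BasisState X w M → ℂ)
      (0, false, (fun _ => false), (fun _ => false)) = 0 := by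
    simp [uniformKet, minusKet, blankLabel, (ht0 _).symm]
  constructor
  · rw [initialState, ← Pi.single_star, single_dotProduct, h, mul_zero]
  · rw [initialState, dotProduct_single, Pi.star_apply, h, star_zero, zero_mul]

theorem initialState_dotProduct_self :
    star (initialState ℂ : BasisState X w M → ℂ) ⬝ᵥ initialState ℂ = 1 := by
  rw [initialState, dotProduct_single, Pi.star_apply, Pi.single_eq_same, star_one, one_mul]

theorem groverOp_mem_unitaryGroup [Nonempty τ] {t : τ → X} (ht : Function.Injective t)
    (ht0 : ∀ i, t i ≠ 0) (i : ℕ) :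
    (groverOp t i : Matrix (BasisState X w M) _ ℂ) ∈ unitaryGroup (BasisState X w M) ℂ := by
  rw [groverOp]
  split_ifs
  · apply householder_mem_unitaryGroup
    obtain ⟨h1, h2⟩ := initialState_dotProduct_uniformKet (w := w) (M := M) ht0
    rw [star_smul, smul_dotProduct, dotProduct_smul, star_sub, sub_dotProduct, dotProduct_sub,
      dotProduct_sub, h1, h2, initialState_dotProduct_self, uniformKet_dotProduct_self ht]
    have h := inv_sqrt_two_mul_self
    simp only [star_inv₀, RCLike.star_def, Complex.conj_ofReal, smul_eq_mul]
    linear_combination 2 * h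
  · exact neg_mem_unitaryGroup (householder_mem_unitaryGroup (uniformKet_dotProduct_self ht))

theorem groverOp_zero_mulVec {t : τ → X} (ht0 : ∀ i, t i ≠ 0) :
    groverOp t 0 *ᵥ (initialState ℂ : BasisState X w M → ℂ) = uniformKet t := by
  obtain ⟨-, h2⟩ := initialState_dotProduct_uniformKet (w := w) (M := M) ht0
  rw [groverOp, if_pos rfl, householder_mulVec, star_smul, smul_dotProduct, star_sub,
    sub_dotProduct, h2, initialState_dotProduct_self, smul_smul]
  have h := inv_sqrt_two_mul_self
  have h' : 2 * (star ((√2 : ℝ) : ℂ)⁻¹ • ((1 : ℂ) - 0)) * ((√2 : ℝ) : ℂ)⁻¹ = 1 := by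
    simp only [star_inv₀, RCLike.star_def, Complex.conj_ofReal, smul_eq_mul]
    linear_combination 2 * h
  rw [h', one_smul, sub_sub_cancel]

/-- The state of Grover's algorithm stays in the plane spanned by the marked query and the sum of
the other ones, in which an iteration is the rotation by `2 * θ`. -/
theorem finalState_groverOp [DecidableEq τ] {t : τ → X} (ht : Function.Injective t)
    (ht0 : ∀ i, t i ≠ 0) {f : X → Bool} {i₀ : τ} (hf : ∀ i, f (t i) = decide (i = i₀)) {θ : ℝ}
    (hsin : Real.sin θ = (√(Fintype.card τ : ℝ))⁻¹) (hcos : Real.cos θ ≠ 0) :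
    ∀ k : ℕ, finalState f k (fun i : Fin (k + 1) => groverOp t i) =
      ((Real.sin ((2 * k + 1) * θ) : ℝ) : ℂ) • (minusKet (t i₀) : BasisState X w M → ℂ) +
      ((Real.cos ((2 * k + 1) * θ) * Real.sin θ / Real.cos θ : ℝ) : ℂ) •
        ∑ i ∈ Finset.univ.erase i₀, minusKet (t i) := by
  have hψ : (uniformKet t : BasisState X w M → ℂ) = ((Real.sin θ : ℝ) : ℂ) •
      (minusKet (t i₀) + ∑ i ∈ Finset.univ.erase i₀, minusKet (t i)) := by
    rw [Finset.add_sum_erase Finset.univ (fun i => minusKet (t i)) (Finset.mem_univ i₀),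
      uniformKet, hsin, Complex.ofReal_inv]
  -- With `N` candidates `sin² θ = 1/N`, so `tan θ = 1/√(N - 1)`. This is the normalizing factor of
  -- the sum of the unmarked kets, which explains the second coefficient of the claimed state.
  have hN : Real.sin θ ^ 2 * Fintype.card τ = 1 := by
    have : Nonempty τ := ⟨i₀⟩
    rw [hsin, inv_pow, Real.sq_sqrt (by positivity), inv_mul_cancel₀ (by simp)]
  have hcard : ((Finset.univ.erase i₀).card : ℝ) = Fintype.card τ - 1 := by
    rw [Finset.card_erase_of_mem (Finset.mem_univ _), Finset.card_univ,
      Nat.cast_sub (Fintype.card_pos_iff.mpr ⟨i₀⟩), Nat.cast_one]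
  intro k
  induction k with
  | zero =>
    simp only [finalState, Fin.val_zero, groverOp_zero_mulVec ht0, hψ]
    simp only [CharP.cast_eq_zero, mul_zero, zero_add, one_mul, mul_div_cancel_left₀ _ hcos,
      smul_add]
  | succ k ih =>
    simp only [finalState, Fin.val_castSucc, ih, Fin.val_last]
    have hO : queryOp ℂ f *ᵥ (∑ i ∈ Finset.univ.erase i₀, minusKet (t i) :
        BasisState X w M → ℂ) = ∑ i ∈ Finset.univ.erase i₀, minusKet (t i) := by
      rw [mulVec_sum]
      refine Finset.sum_congr rfl fun i hi => ?_
      simp [queryOp_mulVec_minusKet, hf, Finset.ne_of_mem_erase hi]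
    have hd : star (uniformKet t : BasisState X w M → ℂ) ⬝ᵥ
        (∑ i ∈ Finset.univ.erase i₀, minusKet (t i)) =
        (((Fintype.card τ - 1) * Real.sin θ : ℝ) : ℂ) := by
      rw [dotProduct_sum]
      simp only [uniformKet_dotProduct_minusKet ht, Finset.sum_const, nsmul_eq_mul]
      rw [hsin, ← hcard]
      push_cast
      rfl
    have hd0 : star (uniformKet t : BasisState X w M → ℂ) ⬝ᵥ minusKet (t i₀) =
        ((Real.sin θ : ℝ) : ℂ) := by
      rw [uniformKet_dotProduct_minusKet ht, hsin, Complex.ofReal_inv]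
    rw [groverOp, if_neg (Nat.succ_ne_zero k), neg_mulVec, householder_mulVec, mulVec_add,
      mulVec_smul, mulVec_smul, hO, queryOp_mulVec_minusKet, hf, dotProduct_add,
      dotProduct_smul, dotProduct_smul, dotProduct_smul, hd, hd0, hψ]
    simp only [decide_true, if_true, smul_eq_mul]
    set α : ℝ := (2 * k + 1) * θ with hα
    have hα' : (2 * ((k + 1 : ℕ) : ℝ) + 1) * θ = α + 2 * θ := by
      rw [hα]
      push_cast
      ring
    set S := Real.sin θ
    set K := Real.cos θ
    have hSK : S ^ 2 + K ^ 2 = 1 := Real.sin_sq_add_cos_sq θ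
    rw [hα', Real.sin_add, Real.cos_add, Real.sin_two_mul, Real.cos_two_mul]
    change _ = ((Real.sin α * (2 * K ^ 2 - 1) + Real.cos α * (2 * S * K) : ℝ) : ℂ) • _ +
      (((Real.cos α * (2 * K ^ 2 - 1) - Real.sin α * (2 * S * K)) * S / K : ℝ) : ℂ) • _
    set u := Real.sin α
    set v := Real.cos α
    -- The right-hand sides of `e1` and `e2` are the coefficients after the sign flip and the
    -- reflection about `uniformKet t`; the left-hand sides are those of the rotated angle `α + 2θ`.
    have e1 : u * (2 * K ^ 2 - 1) + v * (2 * S * K) =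
        u + 2 * (-(u * S) + v * S / K * ((Fintype.card τ - 1) * S)) * S := by
      field_simp
      linear_combination (-2 * v * S) * hN + 2 * v * S * hSK + 2 * K * u * hSK
    have e2 : (v * (2 * K ^ 2 - 1) - u * (2 * S * K)) * S / K =
        -(v * S / K) + 2 * (-(u * S) + v * S / K * ((Fintype.card τ - 1) * S)) * S := by
      field_simp
      linear_combination (-2 * v * S) * hN + 2 * v * S * hSK
    rw [e1, e2]
    push_cast
    module

end Grover

end QueryModel

/-! ### Number of iterations and success probability of Grover search. -/

namespace QueryModel

open Matrix

theorem exists_rotation_count {θ : ℝ} (h0 : 0 < θ) (h1 : θ ≤ Real.pi / 2) :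
    ∃ k : ℕ, (k : ℝ) * Real.sin θ ≤ 1 ∧
      Real.cos θ ^ 2 ≤ Real.sin ((2 * k + 1) * θ) ^ 2 := by
  have hpi := Real.pi_pos
  have h4 : Real.pi ≤ 4 := Real.pi_le_four
  -- This count brings `(2k + 1)θ` within `θ` of `π/2`, where the sine is at least `cos θ`. Also `k
  -- sin θ ≤ kθ ≤ π/4 ≤ 1`.
  refine ⟨⌊Real.pi / (4 * θ)⌋₊, ?_, ?_⟩
  all_goals
    have hle := Nat.floor_le (by positivity : 0 ≤ Real.pi / (4 * θ))
    have hlt := Nat.lt_floor_add_one (Real.pi / (4 * θ))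
    set k : ℝ := (⌊Real.pi / (4 * θ)⌋₊ : ℝ)
    rw [le_div_iff₀ (by positivity)] at hle
    rw [div_lt_iff₀ (by positivity)] at hlt
  · have hk : (0 : ℝ) ≤ k := Nat.cast_nonneg _
    have := mul_le_mul_of_nonneg_left (Real.sin_le h0.le) hk
    linarith
  · have hc : Real.cos θ ≤ Real.sin ((2 * k + 1) * θ) := by
      rw [← Real.cos_sub_pi_div_two, ← Real.cos_abs ((2 * k + 1) * θ - Real.pi / 2)]
      refine Real.cos_le_cos_of_nonneg_of_le_pi (abs_nonneg _) (by linarith) ?_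
      rw [abs_le]
      constructor <;> linarith
    exact pow_le_pow_left₀ (Real.cos_nonneg_of_neg_pi_div_two_le_of_le (by linarith) h1) hc 2

section Grover

variable {X : Type} [Fintype X] [DecidableEq X] {M : ℕ}

/-- Add the value of `out` at the query register to the output register. -/
def outputMap {w : ℕ} (out : X → Fin M → Bool) (b : BasisState X w M) : BasisState X w M :=
  (b.1, b.2.1, b.2.2.1, fun i => xor (b.2.2.2 i) (out b.1 i))

omit [Fintype X] [DecidableEq X] in
theorem outputMap_involutive {w : ℕ} (out : X → Fin M → Bool) :
    Function.Involutive (outputMap out : BasisState X w M → BasisState X w M) := by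
  intro b
  simp [outputMap]

variable [Zero X]

/-- Post-processing is absorbed into the last operation and costs no query. -/
theorem finalState_update_last {w : ℕ} (f : X → Bool) (k : ℕ)
    (U : Fin (k + 1) → Matrix (BasisState X w M) (BasisState X w M) ℂ)
    (V : Matrix (BasisState X w M) (BasisState X w M) ℂ) :
    finalState f k (Function.update U (Fin.last k) (V * U (Fin.last k))) =
      V *ᵥ finalState f k U := by
  cases k with
  | zero => simp [finalState]
  | succ k =>
    have h (i : Fin (k + 1)) : Function.update U (Fin.last (k + 1)) (V * U (Fin.last (k + 1)))
        i.castSucc = U i.castSucc := Function.update_of_ne (Fin.castSucc_lt_last i).ne _ _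
    simp only [finalState, h, Function.update_self, ← mulVec_mulVec]

/-- Grover search: a unique marked query among at least three candidates is found, with
probability at least `2/3`, by a number of queries at most the square root of the number
of candidates. -/
theorem exists_grover_search {τ : Type} [Fintype τ] [DecidableEq τ] (hτ : 3 ≤ Fintype.card τ)
    {t : τ → X} (ht : Function.Injective t) (ht0 : ∀ i, t i ≠ 0) (w : ℕ)
    (out : X → Fin M → Bool) :
    ∃ k : ℕ, (k : ℝ) ≤ √(Fintype.card τ) ∧
      ∃ U : Fin (k + 1) → Matrix (BasisState X w M) (BasisState X w M) ℂ,
        (∀ i, U i ∈ unitaryGroup (BasisState X w M) ℂ) ∧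
        ∀ (f : X → Bool) (i₀ : τ), (∀ i, f (t i) = decide (i = i₀)) →
          2 / 3 ≤ ∑ x : X, ∑ a : Bool, ∑ z : Fin w → Bool,
            ‖finalState f k U (x, a, z, out (t i₀))‖ ^ 2 := by
  have hN : (3 : ℝ) ≤ Fintype.card τ := by exact_mod_cast hτ
  have hs0 : (0 : ℝ) < √(Fintype.card τ) := Real.sqrt_pos.mpr (by linarith)
  have hs1 : (1 : ℝ) < √(Fintype.card τ) := by
    rw [Real.lt_sqrt one_pos.le]
    linarith
  have : Nonempty τ := Fintype.card_pos_iff.mp (by omega)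
  set θ := Real.arcsin (√(Fintype.card τ : ℝ))⁻¹
  have hsin : Real.sin θ = (√(Fintype.card τ : ℝ))⁻¹ :=
    Real.sin_arcsin (by linarith [inv_pos.mpr hs0]) (inv_le_one_of_one_le₀ hs1.le)
  -- `cos² θ = 1 - 1/N`, which is where at least three candidates are needed.
  have hcos2 : 2 / 3 ≤ Real.cos θ ^ 2 := by
    rw [Real.cos_sq', hsin, inv_pow, Real.sq_sqrt (by linarith)]
    have := inv_anti₀ (by norm_num) hN
    linarith
  have hcos : Real.cos θ ≠ 0 := by
    intro h
    rw [h] at hcos2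
    norm_num at hcos2
  obtain ⟨k, hk, hrot⟩ := exists_rotation_count
    (Real.arcsin_pos.mpr (inv_pos.mpr hs0) : 0 < θ) (Real.arcsin_le_pi_div_two _)
  set W : Fin (k + 1) → Matrix (BasisState X w M) (BasisState X w M) ℂ := fun i => groverOp t i
  have hW (i) : W i ∈ unitaryGroup (BasisState X w M) ℂ := groverOp_mem_unitaryGroup ht ht0 i
  set V : Matrix (BasisState X w M) (BasisState X w M) ℂ := mapOp ℂ (outputMap out)
  have hV : V ∈ unitaryGroup (BasisState X w M) ℂ :=
    mapOp_mem_unitaryGroup (outputMap_involutive out).injective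
  refine ⟨k, ?_, Function.update W (Fin.last k) (V * W (Fin.last k)), fun i => ?_,
    fun f i₀ hf => ?_⟩
  · rwa [hsin, ← div_eq_mul_inv, div_le_one hs0] at hk
  · by_cases hi : i = Fin.last k
    · subst hi
      rw [Function.update_self]
      exact mul_mem hV (hW _)
    · rw [Function.update_of_ne hi]
      exact hW i
  · rw [finalState_update_last, finalState_groverOp ht ht0 hf hsin hcos k,
      mapOp_mulVec_of_involutive ℂ (outputMap_involutive out)]
    set α := (2 * (k : ℝ) + 1) * θ
    have hne (i : τ) (hi : i ∈ Finset.univ.erase i₀) (a : Bool) :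
        (minusKet (t i) : BasisState X w M → ℂ) (blankLabel (t i₀) a) = 0 := by
      have : t i₀ ≠ t i := fun h => Finset.ne_of_mem_erase hi (ht h).symm
      simp [minusKet, blankLabel, this]
    have heq (a : Bool) : ‖(minusKet (t i₀) : BasisState X w M → ℂ) (blankLabel (t i₀) a)‖ ^ 2 =
        1 / 2 := by
      cases a <;> simp [minusKet, blankLabel]
    -- The output register is still zero before `outputMap`, so the amplitude of the correct output
    -- is the earlier amplitude at the blank label of the marked query. The two answer bits
    -- contribute half of the success probability each.
    have hout (a : Bool) : outputMap out (t i₀, a, (fun _ : Fin w => false), out (t i₀)) =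
        blankLabel (t i₀) a := by
      simp [outputMap, blankLabel]
    refine hcos2.trans (hrot.trans ?_)
    refine le_trans ?_ (Finset.single_le_sum (fun _ _ => ?_) (Finset.mem_univ (t i₀)))
    · refine le_trans (le_of_eq ?_) (Finset.sum_le_sum fun a _ => Finset.single_le_sum
        (fun _ _ => ?_) (Finset.mem_univ (fun _ : Fin w => false)))
      · simp only [hout, Pi.add_apply, Pi.smul_apply, Finset.sum_apply, smul_eq_mul,
          Finset.sum_eq_zero fun i hi => hne i hi _, mul_zero, add_zero, norm_mul, mul_pow, heq,
          Complex.norm_real, Real.norm_eq_abs, sq_abs]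
        rw [Finset.sum_const, Finset.card_univ, Fintype.card_bool, nsmul_eq_mul]
        push_cast
        ring
      · positivity
    · positivity

end Grover

end QueryModel

/-! ### Quantum upper bound by search over the projective line. -/

namespace HiddenCyclicGroup

open QueryModel

/-- Representatives of the points of the projective line over `ℤ_p`. Each `Id_s` vanishes on all
of them but one, which is never the point at infinity. -/
def projectivePoint {p : ℕ} : Option (ZMod p) → Fin 2 → ZMod p
  | some j => ![j, -1]
  | none => ![1, 0]

theorem projectivePoint_injective (p : ℕ) [Fact p.Prime] :
    Function.Injective (projectivePoint (p := p)) := by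
  rintro (_ | i) (_ | j) h
  · rfl
  · simpa [projectivePoint] using congrFun h 1
  · simpa [projectivePoint] using congrFun h 1
  · simpa [projectivePoint] using congrFun h 0

theorem projectivePoint_ne_zero {p : ℕ} [Fact p.Prime] (i : Option (ZMod p)) :
    projectivePoint i ≠ 0 := by
  intro h
  rcases i with _ | i
  · simpa [projectivePoint] using congrFun h 0
  · simpa [projectivePoint] using congrFun h 1

theorem secretOracle_projectivePoint {p : ℕ} [Fact p.Prime] (s : ZMod p)
    (i : Option (ZMod p)) : secretOracle s (projectivePoint i) = decide (i = some s) := by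
  rcases i with _ | i
  · simp [projectivePoint, secretOracle_apply]
  · simp [projectivePoint, secretOracle_apply, add_neg_eq_zero]

theorem exists_quantumSolvable_secretProblem (p : ℕ) [Fact p.Prime] :
    ∃ k : ℕ, (k : ℝ) ≤ 2 * √p ∧ QuantumSolvable (secretProblem p) k := by
  have hp : 2 ≤ p := (Fact.out : p.Prime).two_le
  have hcard : Fintype.card (Option (ZMod p)) = p + 1 := by simp [ZMod.card]
  -- The never-marked point at infinity raises the number of candidates to `p + 1`, so that `p = 2`
  -- also has three.
  obtain ⟨k, hk, U, hU, h⟩ := exists_grover_search (τ := Option (ZMod p)) (by omega)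
    (projectivePoint_injective p) projectivePoint_ne_zero 0
    (fun x : Fin 2 → ZMod p => encode (x 0))
  refine ⟨k, hk.trans ?_, 0, U, hU, ?_⟩
  · rw [hcard, Real.sqrt_le_iff]
    refine ⟨by positivity, ?_⟩
    have : (2 : ℝ) ≤ p := by exact_mod_cast hp
    rw [mul_pow, Real.sq_sqrt (by positivity)]
    push_cast
    linarith
  · rintro ⟨_, s, rfl⟩
    rw [secretProblem_answer]
    exact h (secretOracle s) (some s) (secretOracle_projectivePoint s)

end HiddenCyclicGroup

theorem corollary1 :
    (∃ c C : ℝ, 0 < c ∧ 0 < C ∧ ∀ (p : ℕ) [Fact p.Prime],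
      c * (p : ℝ) ≤
          (QueryModel.randomizedComplexity (HiddenCyclicGroup.secretProblem p) : ℝ) ∧
        (QueryModel.randomizedComplexity (HiddenCyclicGroup.secretProblem p) : ℝ) ≤
          C * (p : ℝ)) ∧
    (∃ c C : ℝ, 0 < c ∧ 0 < C ∧ ∀ (p : ℕ) [Fact p.Prime],
      c * Real.sqrt (p : ℝ) ≤
          (QueryModel.quantumComplexity (HiddenCyclicGroup.secretProblem p) : ℝ) ∧
        (QueryModel.quantumComplexity (HiddenCyclicGroup.secretProblem p) : ℝ) ≤
          C * Real.sqrt (p : ℝ)) := by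
  refine ⟨⟨1 / 12, 1, by norm_num, by norm_num, fun p _ => ⟨?_, ?_⟩⟩,
    ⟨1 / 20, 2, by norm_num, by norm_num, fun p _ => ⟨?_, ?_⟩⟩⟩
  -- The infimum of an empty set of naturals is 0, so each lower bound needs the existence of an
  -- algorithm from the upper bound to know that the infimum is attained.
  · exact HiddenCyclicGroup.randomized_lower_bound p _
      (Nat.sInf_mem (s := {k | QueryModel.RandomizedSolvable _ k})
        ⟨p, HiddenCyclicGroup.randomizedSolvable_secretProblem p⟩)
  · rw [one_mul]
    exact_mod_cast Nat.sInf_le (HiddenCyclicGroup.randomizedSolvable_secretProblem p)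
  · obtain ⟨k, -, hk⟩ := HiddenCyclicGroup.exists_quantumSolvable_secretProblem p
    exact HiddenCyclicGroup.quantum_lower_bound p _
      (Nat.sInf_mem (s := {k | QueryModel.QuantumSolvable _ k}) ⟨k, hk⟩)
  · obtain ⟨k, hle, hk⟩ := HiddenCyclicGroup.exists_quantumSolvable_secretProblem p
    exact le_trans (by exact_mod_cast Nat.sInf_le hk) hle
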